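/- Consider the following forest fire model on $\mathbb{Z}_+=\{0,1,2,\dots\}$ with instant spread ($\Delta\equiv 0$) and constant burning time $\theta>0$. Initially all sites are vacant. At each vacant (non-burning) site a tree appears after an $\mathrm{Exp}(1)$-distributed waiting time, and all these waiting times are independent. A tree that catches fire at time $t$ burns during $[t,t+\theta)$, after which its site is vacant; while it burns, no tree can grow at its site and the site cannot be ignited again. A tree at site $0$ starts burning as soon as it appears. A non-burning tree at site $x+1$ starts burning at the first moment, from its appearance on, at which site $x$ is burning; this burning of $x+1$ belongs to the same fire as the burning of $x$ that ignited it. The $k$-th fire is the one that starts with the $k$-th burning of site $0$. Let $m_1$ be the right-most site burnt by the first fire and, for $k\ge 2$, let $m_k$ be the right-most site burnt by the first fire that reaches beyond $m_{k-1}$ (with $m_k=\infty$ if such a fire never stops, and $m_k=\infty$ if $m_{k-1}=\infty$). Theorem. For every constant $\theta>0$ there is a (non-random) $\alpha>0$ such that almost surely $m_i\ge \exp(\exp(\alpha i))$ for all sufficiently large $i$. -/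

import Mathlib

open MeasureTheory ProbabilityTheory Filter
open scoped ENNReal

noncomputable section

namespace ForestFire

/-- Burning starts at a site whose trees burn for time `θ`, when the `k`-th tree to appear there
(counted from `k = 0`) needs a waiting time `τ k` counted from the moment the site became vacant
(time `0` if `k = 0`), and when a tree that appears at time `g` catches fire at time `catchAt g`. -/
def burnSeq (θ : ℝ) (catchAt : ℝ → ℝ) (τ : ℕ → ℝ) : ℕ → ℝ
  | 0 => catchAt (τ 0)
  | k + 1 => catchAt (burnSeq θ catchAt τ k + θ + τ (k + 1))

/-- The time at which a tree that appears at time `g` catches fire, if the site on its left starts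
burning at the times `f i` and burns during `[f i, f i + θ)`: the first time from `g` on at which
the left neighbour burns (the fire spreads without delay). -/
def catchFire (θ : ℝ) (f : ℕ → ℝ) (g : ℝ) : ℝ :=
  sInf {s : ℝ | g ≤ s ∧ ∃ i, f i ≤ s ∧ s < f i + θ}

/-- `ignition θ τ x i` is the time when site `x` starts burning for the `(i+1)`-st time, in the
forest fire model with instant spread and burning time `θ`, where the `(k+1)`-st tree at site `x`
needs the waiting time `τ x k`. At the origin a tree starts burning as soon as it appears; at
`x + 1` it starts burning as soon as it is reached by fire from `x`. -/
def ignition (θ : ℝ) (τ : ℕ → ℕ → ℝ) : ℕ → ℕ → ℝ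
  | 0 => burnSeq θ id (τ 0)
  | x + 1 => burnSeq θ (catchFire θ (ignition θ τ x)) (τ (x + 1))

/-- `BelongsToFire θ τ k x j`: the `(j+1)`-st burning of site `x` is part of the `(k+1)`-st fire,
that is, of the fire that starts with the `(k+1)`-st burning of the origin. A burning of `x + 1`
is part of the same fire as the burning of `x` during which it was ignited. -/
def BelongsToFire (θ : ℝ) (τ : ℕ → ℕ → ℝ) (k : ℕ) : ℕ → ℕ → Prop
  | 0, j => j = k
  | x + 1, j => ∃ i, BelongsToFire θ τ k x i ∧ ignition θ τ x i ≤ ignition θ τ (x + 1) j ∧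
      ignition θ τ (x + 1) j < ignition θ τ x i + θ

/-- The right-most site burnt by the `(k+1)`-st fire (`⊤` if the fire never stops). -/
def fireExtent (θ : ℝ) (τ : ℕ → ℕ → ℝ) (k : ℕ) : ℕ∞ :=
  ⨆ x ∈ {x : ℕ | ∃ j, BelongsToFire θ τ k x j}, (x : ℕ∞)

open Classical in
/-- The successive maxima: `maxima θ τ 0` is the right-most site burnt by the first fire, and
`maxima θ τ (i + 1)` is the right-most site burnt by the first fire which reaches beyond
`maxima θ τ i` (`⊤` if `maxima θ τ i = ⊤`). So `maxima θ τ i` is the maximum with number `i + 1`. -/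
def maxima (θ : ℝ) (τ : ℕ → ℕ → ℝ) : ℕ → ℕ∞
  | 0 => fireExtent θ τ 0
  | i + 1 => if maxima θ τ i = ⊤ then ⊤
      else fireExtent θ τ (sInf {k : ℕ | maxima θ τ i < fireExtent θ τ k})

end ForestFire

end

namespace ForestFire

/-! ### Fire passing from one site to its right neighbour -/

section Spread

variable {θ : ℝ} {f : ℕ → ℝ}

/-! Let `M < M'` be consecutive finite maxima. No earlier fire passed `M'`, so the fire stopping
there finds `M' + 1` never yet grown: the first waiting time at `M' + 1` exceeds the current time
(`ignition_add_le_waiting`). That time is at least a first waiting time at some `y < M / 2`, needed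
by the fire that stopped at `M`, plus a regrowth time behind that fire at some `x` in `(M / 2, M]`
(`exists_fire_of_maxima`).

By Borel–Cantelli, for large `M` both can be chosen above `3/4 * log M`, while first waiting times
at `L` stay below `5/4 * log L`. Hence `3/2 * log M ≤ 5/4 * log (M' + 1)`: the logarithms of the
maxima grow geometrically, with a rate independent of `θ`.

The delicate point is regrowth, since the index of the tree behind a given fire is random. Whether a
burning belongs to that fire is decided by the sites to the left and the waiting times up to that
burning, so the next waiting time is still independent (`measure_fastRegrowth_succ_le`). -/

lemma monotone_of_gaps (hθ : 0 < θ) (hf : ∀ i, f i + θ ≤ f (i + 1)) : Monotone f :=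
  monotone_nat_of_le_succ fun i => by linarith [hf i]

lemma gap_of_lt (hθ : 0 < θ) (hf : ∀ i, f i + θ ≤ f (i + 1)) {i j : ℕ} (h : i < j) :
    f i + θ ≤ f j :=
  (hf i).trans (monotone_of_gaps hθ hf h)

lemma mul_le_of_gaps (hf0 : 0 ≤ f 0) (hf : ∀ i, f i + θ ≤ f (i + 1)) (i : ℕ) : i * θ ≤ f i := by
  induction i with
  | zero => simpa using hf0
  | succ i ih => push_cast; linarith [hf i]

lemma exists_lt_add_of_gaps (hθ : 0 < θ) (hf0 : 0 ≤ f 0) (hf : ∀ i, f i + θ ≤ f (i + 1)) (g : ℝ) :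
    ∃ i, g < f i + θ := by
  obtain ⟨n, hn⟩ := exists_nat_gt (g / θ)
  rw [div_lt_iff₀ hθ] at hn
  exact ⟨n, by linarith [mul_le_of_gaps hf0 hf n]⟩

/-- The first time from `g` on at which the left neighbour burns is attained. -/
lemma isLeast_catchFire (hθ : 0 < θ) (hf0 : 0 ≤ f 0) (hf : ∀ i, f i + θ ≤ f (i + 1)) (g : ℝ) :
    IsLeast {s : ℝ | g ≤ s ∧ ∃ i, f i ≤ s ∧ s < f i + θ} (catchFire θ f g) := by
  classical
  have hex := exists_lt_add_of_gaps hθ hf0 hf g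
  have hl : IsLeast {s : ℝ | g ≤ s ∧ ∃ i, f i ≤ s ∧ s < f i + θ} (max g (f (Nat.find hex))) := by
    refine ⟨⟨le_max_left _ _, Nat.find hex, le_max_right _ _,
      max_lt (Nat.find_spec hex) (by linarith)⟩, ?_⟩
    rintro s ⟨hgs, i, his, hsi⟩
    exact max_le hgs ((monotone_of_gaps hθ hf (Nat.find_min' hex (hgs.trans_lt hsi))).trans his)
  rw [catchFire, hl.csInf_eq]
  exact hl

/-- Rewrites the infimum as a countable union of strict comparisons, which gives measurability. -/
lemma catchFire_lt_iff (hθ : 0 < θ) (hf0 : 0 ≤ f 0) (hf : ∀ i, f i + θ ≤ f (i + 1)) (g c : ℝ) :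
    catchFire θ f g < c ↔ ∃ i, g < f i + θ ∧ g < c ∧ f i < c := by
  have hl := isLeast_catchFire hθ hf0 hf g
  constructor
  · intro h
    obtain ⟨hg, i, hi, hi'⟩ := hl.1
    exact ⟨i, hg.trans_lt hi', hg.trans_lt h, hi.trans_lt h⟩
  · rintro ⟨i, hi, hg, hc⟩
    exact (hl.2 ⟨le_max_left _ _, i, le_max_right _ _, max_lt hi (by linarith)⟩).trans_lt
      (max_lt hg hc)

end Spread

/-! ### Deterministic structure of fires and maxima -/

section Dynamics

variable {θ : ℝ} {τ : ℕ → ℕ → ℝ}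

lemma ignition_bounds (hθ : 0 < θ) (hτ : ∀ x k, 0 ≤ τ x k) (x : ℕ) :
    τ x 0 ≤ ignition θ τ x 0 ∧
      ∀ j, ignition θ τ x j + θ + τ x (j + 1) ≤ ignition θ τ x (j + 1) := by
  induction x with
  | zero => exact ⟨le_rfl, fun j => le_rfl⟩
  | succ x ih =>
    have hf0 : 0 ≤ ignition θ τ x 0 := (hτ x 0).trans ih.1
    have hf : ∀ i, ignition θ τ x i + θ ≤ ignition θ τ x (i + 1) :=
      fun i => by linarith [ih.2 i, hτ x (i + 1)]
    exact ⟨(isLeast_catchFire hθ hf0 hf _).1.1, fun j => (isLeast_catchFire hθ hf0 hf _).1.1⟩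

lemma ignition_zero_nonneg (hθ : 0 < θ) (hτ : ∀ x k, 0 ≤ τ x k) (x : ℕ) :
    0 ≤ ignition θ τ x 0 :=
  (hτ x 0).trans (ignition_bounds hθ hτ x).1

lemma ignition_gap (hθ : 0 < θ) (hτ : ∀ x k, 0 ≤ τ x k) (x i : ℕ) :
    ignition θ τ x i + θ ≤ ignition θ τ x (i + 1) := by
  linarith [(ignition_bounds hθ hτ x).2 i, hτ x (i + 1)]

lemma ignition_mono (hθ : 0 < θ) (hτ : ∀ x k, 0 ≤ τ x k) (x : ℕ) : Monotone (ignition θ τ x) :=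
  monotone_of_gaps hθ (ignition_gap hθ hτ x)

lemma waiting_le_ignition (hθ : 0 < θ) (hτ : ∀ x k, 0 ≤ τ x k) (x j : ℕ) :
    τ x 0 ≤ ignition θ τ x j :=
  (ignition_bounds hθ hτ x).1.trans (ignition_mono hθ hτ x j.zero_le)

lemma waiting_le_ignition_of_lt (hθ : 0 < θ) (hτ : ∀ x k, 0 ≤ τ x k) (x : ℕ) {i j : ℕ}
    (h : i < j) : ignition θ τ x i + τ x (i + 1) ≤ ignition θ τ x j := by
  linarith [(ignition_bounds hθ hτ x).2 i, ignition_mono hθ hτ x (Nat.succ_le_of_lt h)]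

lemma exists_parent (hθ : 0 < θ) (hτ : ∀ x k, 0 ≤ τ x k) (x j : ℕ) :
    ∃ i, ignition θ τ x i ≤ ignition θ τ (x + 1) j ∧
      ignition θ τ (x + 1) j < ignition θ τ x i + θ := by
  have h := isLeast_catchFire hθ (ignition_zero_nonneg hθ hτ x) (ignition_gap hθ hτ x)
  cases j with
  | zero => exact (h _).1.2
  | succ j => exact (h _).1.2

lemma exists_belongsToFire (hθ : 0 < θ) (hτ : ∀ x k, 0 ≤ τ x k) (x j : ℕ) :
    ∃ k, BelongsToFire θ τ k x j := by
  induction x generalizing j with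
  | zero => exact ⟨j, rfl⟩
  | succ x ih =>
    obtain ⟨i, hi⟩ := exists_parent hθ hτ x j
    obtain ⟨k, hk⟩ := ih i
    exact ⟨k, i, hk, hi⟩

/-- Fires pass each site in the order of their outbreaks. -/
lemma BelongsToFire.lt_of_lt (hθ : 0 < θ) (hτ : ∀ x k, 0 ≤ τ x k) {k k' x j j' : ℕ}
    (h : BelongsToFire θ τ k x j) (h' : BelongsToFire θ τ k' x j') (hk : k < k') : j < j' := by
  induction x generalizing j j' with
  | zero => cases h; cases h'; exact hk
  | succ x ih =>
    obtain ⟨i, hi, hij, hij'⟩ := h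
    obtain ⟨i', hi', hi1, hi2⟩ := h'
    have := gap_of_lt hθ (ignition_gap hθ hτ x) (ih hi hi')
    exact (ignition_mono hθ hτ (x + 1)).reflect_lt (by linarith)

/-- By induction both burnings have the same parent, hence start in one window of length `θ`, while
distinct burnings of a site start at least `θ` apart. -/
lemma BelongsToFire.eq (hθ : 0 < θ) (hτ : ∀ x k, 0 ≤ τ x k) {k x j j' : ℕ}
    (h : BelongsToFire θ τ k x j) (h' : BelongsToFire θ τ k x j') : j = j' := by
  induction x generalizing j j' with
  | zero => cases h; cases h'; rfl
  | succ x ih =>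
    obtain ⟨i, hi, hij, hij'⟩ := h
    obtain ⟨i', hi', hi1, hi2⟩ := h'
    obtain rfl := ih hi hi'
    rcases lt_trichotomy j j' with hj | hj | hj
    · linarith [gap_of_lt hθ (ignition_gap hθ hτ (x + 1)) hj]
    · exact hj
    · linarith [gap_of_lt hθ (ignition_gap hθ hτ (x + 1)) hj]

lemma BelongsToFire.exists_of_le {k x y j : ℕ} (h : BelongsToFire θ τ k x j) (hy : y ≤ x) :
    ∃ i, BelongsToFire θ τ k y i ∧ ignition θ τ y i ≤ ignition θ τ x j := by
  induction x generalizing j with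
  | zero => obtain rfl : y = 0 := by omega
            exact ⟨j, h, le_rfl⟩
  | succ x ih =>
    rcases Nat.le_succ_iff.1 hy with hy | rfl
    · obtain ⟨i, hi, hij, -⟩ := h
      obtain ⟨l, hl, hli⟩ := ih hi hy
      exact ⟨l, hl, hli.trans hij⟩
    · exact ⟨j, h, le_rfl⟩

lemma mul_le_ignition (hθ : 0 < θ) (hτ : ∀ x k, 0 ≤ τ x k) {k x j : ℕ}
    (h : BelongsToFire θ τ k x j) : k * θ ≤ ignition θ τ x j := by
  obtain ⟨i, hi, hij⟩ := h.exists_of_le x.zero_le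
  cases hi
  exact (mul_le_of_gaps (ignition_zero_nonneg hθ hτ 0) (ignition_gap hθ hτ 0) _).trans hij

lemma le_fireExtent_iff {k n : ℕ} :
    (n : ℕ∞) ≤ fireExtent θ τ k ↔ ∃ j, BelongsToFire θ τ k n j := by
  constructor
  · intro h
    by_contra hn
    -- Truncation at `n = 0` is harmless: every fire burns the origin, which excludes that case.
    have hle : fireExtent θ τ k ≤ ((n - 1 : ℕ) : ℕ∞) := by
      refine iSup₂_le fun x hx => ?_
      obtain ⟨j, hj⟩ := hx
      have : x < n := by
        by_contra! hx
        obtain ⟨i, hi, -⟩ := hj.exists_of_le hx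
        exact hn ⟨i, hi⟩
      exact_mod_cast Nat.le_sub_one_of_lt this
    have hn0 : n ≠ 0 := by
      rintro rfl
      exact hn ⟨k, rfl⟩
    have := h.trans hle
    norm_cast at this
    omega
  · intro h
    exact le_iSup₂ (f := fun (x : ℕ) (_ : x ∈ {x : ℕ | ∃ j, BelongsToFire θ τ k x j}) => (x : ℕ∞))
      n h

lemma exists_lt_fireExtent (hθ : 0 < θ) (hτ : ∀ x k, 0 ≤ τ x k) {e : ℕ∞} (he : e ≠ ⊤) :
    ∃ k, e < fireExtent θ τ k := by
  lift e to ℕ using he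
  obtain ⟨k, hk⟩ := exists_belongsToFire hθ hτ (e + 1) 0
  exact ⟨k, lt_of_lt_of_le (by exact_mod_cast e.lt_succ_self) (le_fireExtent_iff.2 ⟨0, hk⟩)⟩

/-- A fire that stops right after `M`, a site beyond which no earlier fire came, does so because
the first tree at `M + 1` appears only after the burning of `M` has ended. -/
lemma ignition_add_le_waiting (hθ : 0 < θ) (hτ : ∀ x k, 0 ≤ τ x k) {k M j : ℕ}
    (hM : ∀ l ≤ k, fireExtent θ τ l ≤ M) (hj : BelongsToFire θ τ k M j) :
    ignition θ τ M j + θ ≤ τ (M + 1) 0 := by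
  by_contra! hlt
  have hl := isLeast_catchFire hθ (ignition_zero_nonneg hθ hτ M) (ignition_gap hθ hτ M)
    (τ (M + 1) 0)
  have hs : ignition θ τ (M + 1) 0 < ignition θ τ M j + θ :=
    (hl.2 ⟨le_max_left _ _, j, le_max_right _ _, max_lt hlt (by linarith)⟩).trans_lt
      (max_lt hlt (by linarith))
  obtain ⟨i, hi, hi'⟩ := exists_parent hθ hτ M 0
  obtain ⟨l, hl⟩ := exists_belongsToFire hθ hτ M i
  -- A later fire would burn `M` only after burning `j` has ended, too late to cause this ignition.
  have hlk : l ≤ k := by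
    by_contra! hkl
    linarith [gap_of_lt hθ (ignition_gap hθ hτ M) (hj.lt_of_lt hθ hτ hl hkl)]
  have h1 : ((M + 1 : ℕ) : ℕ∞) ≤ fireExtent θ τ l := le_fireExtent_iff.2 ⟨0, i, hl, hi, hi'⟩
  have := h1.trans (hM l hlk)
  norm_cast at this
  omega

lemma maxima_succ_of_ne_top {i : ℕ} (h : maxima θ τ i ≠ ⊤) :
    maxima θ τ (i + 1) = fireExtent θ τ (sInf {k : ℕ | maxima θ τ i < fireExtent θ τ k}) := by
  rw [maxima, if_neg h]

lemma maxima_succ_of_eq_top {i : ℕ} (h : maxima θ τ i = ⊤) : maxima θ τ (i + 1) = ⊤ := by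
  rw [maxima, if_pos h]

lemma maxima_lt_succ (hθ : 0 < θ) (hτ : ∀ x k, 0 ≤ τ x k) {i : ℕ} (h : maxima θ τ i ≠ ⊤) :
    maxima θ τ i < maxima θ τ (i + 1) := by
  rw [maxima_succ_of_ne_top h]
  exact Nat.sInf_mem (exists_lt_fireExtent hθ hτ h)

/-- The fire that realizes a finite maximum breaks out before every fire that reaches beyond. -/
lemma exists_fireExtent_eq_maxima (hθ : 0 < θ) (hτ : ∀ x k, 0 ≤ τ x k) {i : ℕ}
    (h : maxima θ τ i ≠ ⊤) :
    ∃ k, fireExtent θ τ k = maxima θ τ i ∧ ∀ l, maxima θ τ i < fireExtent θ τ l → k < l := by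
  suffices ∃ k, fireExtent θ τ k = maxima θ τ i ∧
      ∀ l, maxima θ τ i < fireExtent θ τ l → k ≤ l by
    obtain ⟨k, hk, hl⟩ := this
    refine ⟨k, hk, fun l h => (hl l h).lt_of_ne ?_⟩
    rintro rfl
    exact h.ne hk.symm
  cases i with
  | zero => exact ⟨0, rfl, fun l _ => l.zero_le⟩
  | succ i =>
    have hi : maxima θ τ i ≠ ⊤ := fun hi => h (maxima_succ_of_eq_top hi)
    exact ⟨_, (maxima_succ_of_ne_top hi).symm,
      fun l hl => Nat.sInf_le ((maxima_lt_succ hθ hτ hi).trans hl)⟩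

/-- Comparison of two consecutive finite maxima `M` and `M'`: the fire with number `k` stops
at `M`, and the first tree at `M' + 1` appears later than the second growth at any site burnt by
that fire. -/
lemma exists_fire_of_maxima (hθ : 0 < θ) (hτ : ∀ x k, 0 ≤ τ x k) {i M M' : ℕ}
    (hM : maxima θ τ i = M) (hM' : maxima θ τ (i + 1) = M') :
    ∃ k, (∃ j, BelongsToFire θ τ k M j) ∧ k * θ ≤ τ (M' + 1) 0 ∧
      ∀ x ≤ M, ∀ y ≤ x, ∀ j, BelongsToFire θ τ k x j →
        τ y 0 + τ x (j + 1) ≤ τ (M' + 1) 0 := by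
  have hne : maxima θ τ i ≠ ⊤ := by simp [hM]
  obtain ⟨k, hk, hkl⟩ := exists_fireExtent_eq_maxima hθ hτ hne
  obtain ⟨k', hk', hkl'⟩ := exists_fireExtent_eq_maxima hθ hτ (i := i + 1) (by simp [hM'])
  have hlt := maxima_lt_succ hθ hτ hne
  have hkk' : k < k' := hkl k' (hk' ▸ hlt)
  obtain ⟨j', hj'⟩ := le_fireExtent_iff.1 (hM'.symm.trans hk'.symm).le
  have hburn := ignition_add_le_waiting hθ hτ (k := k') (M := M') (fun l hl => by
    by_contra! h
    exact (hkl' l (hM' ▸ h)).not_ge hl) hj'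
  have hMM' : M ≤ M' := by
    rw [hM, hM'] at hlt
    exact_mod_cast hlt.le
  have hkM := le_fireExtent_iff.1 (hM.symm.trans hk.symm).le
  refine ⟨k, hkM, ?_, fun x hx y hy j hj => ?_⟩
  · have h1 := mul_le_ignition hθ hτ hj'
    have h2 : (k : ℝ) * θ ≤ k' * θ := by gcongr
    linarith
  -- The later fire `k'` also burns `x`, so the tree lost there to fire `k` must have regrown.
  · obtain ⟨l, hl, hl'⟩ := hj'.exists_of_le (hx.trans hMM')
    have h1 := waiting_le_ignition_of_lt hθ hτ x (hj.lt_of_lt hθ hτ hl hkk')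
    obtain ⟨n, -, hn⟩ := hj.exists_of_le hy
    linarith [waiting_le_ignition hθ hτ y n]

end Dynamics

/-! ### Measurability with respect to an arbitrary σ-algebra, so that sub-σ-algebras are allowed -/

section Measurability

variable {Ω : Type*} {m : MeasurableSpace Ω} {θ : ℝ} {η : ℕ → ℕ → Ω → ℝ}

lemma measurable_catchFire (hθ : 0 < θ) {f : ℕ → Ω → ℝ} {g : Ω → ℝ} (hf0 : ∀ ω, 0 ≤ f 0 ω)
    (hf : ∀ ω i, f i ω + θ ≤ f (i + 1) ω) (hfm : ∀ i, Measurable (f i)) (hg : Measurable g) :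
    Measurable fun ω => catchFire θ (fun i => f i ω) (g ω) := by
  refine measurable_of_Iio fun c => ?_
  have : (fun ω => catchFire θ (fun i => f i ω) (g ω)) ⁻¹' Set.Iio c =
      ⋃ i, ({ω | g ω < f i ω + θ} ∩ ({ω | g ω < c} ∩ {ω | f i ω < c})) := by
    ext ω
    simp [catchFire_lt_iff (f := fun i => f i ω) hθ (hf0 ω) (hf ω)]
  rw [this]
  exact MeasurableSet.iUnion fun i => (measurableSet_lt hg ((hfm i).add_const θ)).inter
    ((measurableSet_lt hg measurable_const).inter (measurableSet_lt (hfm i) measurable_const))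

/-- The burning times of a site up to the `(n + 1)`-st one are determined by those of its left
neighbour and the waiting times for its first `n + 1` trees. -/
lemma measurable_ignition_succ (hθ : 0 < θ) (hη : ∀ x k ω, 0 ≤ η x k ω) {x : ℕ}
    (hx : ∀ i, Measurable fun ω => ignition θ (fun x k => η x k ω) x i) {n : ℕ}
    (hn : ∀ i ≤ n, Measurable (η (x + 1) i)) {j : ℕ} (hj : j ≤ n) :
    Measurable fun ω => ignition θ (fun x k => η x k ω) (x + 1) j := by
  induction j with
  | zero =>
    exact measurable_catchFire hθ (f := fun i ω => ignition θ (fun x k => η x k ω) x i)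
      (fun ω => ignition_zero_nonneg hθ (fun x k => hη x k ω) x)
      (fun ω => ignition_gap hθ (fun x k => hη x k ω) x) hx (hn 0 hj)
  | succ j ih =>
    exact measurable_catchFire hθ (f := fun i ω => ignition θ (fun x k => η x k ω) x i)
      (fun ω => ignition_zero_nonneg hθ (fun x k => hη x k ω) x)
      (fun ω => ignition_gap hθ (fun x k => hη x k ω) x) hx
      (((ih (by omega)).add_const θ).add (hn _ hj))

lemma measurable_ignition (hθ : 0 < θ) (hη : ∀ x k ω, 0 ≤ η x k ω) {x : ℕ}
    (hm : ∀ y ≤ x, ∀ k, Measurable (η y k)) (j : ℕ) :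
    Measurable fun ω => ignition θ (fun x k => η x k ω) x j := by
  induction x generalizing j with
  | zero =>
    induction j with
    | zero => exact hm 0 le_rfl 0
    | succ j ih => exact (ih.add_const θ).add (hm 0 le_rfl _)
  | succ x ih =>
    exact measurable_ignition_succ hθ hη (fun i => ih (fun y hy => hm y (hy.trans x.le_succ)) i)
      (fun i _ => hm _ le_rfl i) le_rfl

/-- At `x + 1` only the burning `j` has to be measurable, so later waiting times there stay out of
the σ-algebra. -/
lemma measurableSet_belongsToFire_succ {k x j : ℕ}
    (hx : ∀ i, Measurable fun ω => ignition θ (fun x k => η x k ω) x i)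
    (hj : Measurable fun ω => ignition θ (fun x k => η x k ω) (x + 1) j)
    (hb : ∀ i, MeasurableSet {ω | BelongsToFire θ (fun x k => η x k ω) k x i}) :
    MeasurableSet {ω | BelongsToFire θ (fun x k => η x k ω) k (x + 1) j} := by
  have : {ω | BelongsToFire θ (fun x k => η x k ω) k (x + 1) j} =
      ⋃ i, {ω | BelongsToFire θ (fun x k => η x k ω) k x i} ∩
        ({ω | ignition θ (fun x k => η x k ω) x i ≤ ignition θ (fun x k => η x k ω) (x + 1) j} ∩
        {ω | ignition θ (fun x k => η x k ω) (x + 1) j <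
          ignition θ (fun x k => η x k ω) x i + θ}) := by
    ext ω
    simp [BelongsToFire]
  rw [this]
  exact MeasurableSet.iUnion fun i => (hb i).inter
    ((measurableSet_le (hx i) hj).inter (measurableSet_lt hj ((hx i).add_const θ)))

lemma measurableSet_belongsToFire (hθ : 0 < θ) (hη : ∀ x k ω, 0 ≤ η x k ω) {x : ℕ}
    (hm : ∀ y ≤ x, ∀ k, Measurable (η y k)) (k j : ℕ) :
    MeasurableSet {ω | BelongsToFire θ (fun x k => η x k ω) k x j} := by
  induction x generalizing j with
  | zero => simp [BelongsToFire]
  | succ x ih =>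
    have hm' : ∀ y ≤ x, ∀ k, Measurable (η y k) := fun y hy => hm y (hy.trans x.le_succ)
    exact measurableSet_belongsToFire_succ (measurable_ignition hθ hη hm')
      (measurable_ignition hθ hη hm j) fun i => ih hm' i

/-- The `k`-th fire reaches `x`, and wherever it passed in `(H, x]`, the next tree appeared within
the waiting time `s`. -/
def fastRegrowth (θ : ℝ) (η : ℕ → ℕ → Ω → ℝ) (k H : ℕ) (s : ℝ) (x : ℕ) : Set Ω :=
  {ω | (∃ j, BelongsToFire θ (fun x k => η x k ω) k x j) ∧
    ∀ y ≤ x, H < y → ∀ j, BelongsToFire θ (fun x k => η x k ω) k y j → η y (j + 1) ω ≤ s}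

lemma measurableSet_fastRegrowth (hθ : 0 < θ)
    (hη : ∀ x k ω, 0 ≤ η x k ω) {x : ℕ} (hm : ∀ y ≤ x, ∀ k, Measurable (η y k)) (k H : ℕ)
    (s : ℝ) : MeasurableSet (fastRegrowth θ η k H s x) := by
  have hb := fun y (hy : y ≤ x) j =>
    measurableSet_belongsToFire hθ hη (fun z hz => hm z (hz.trans hy)) k j
  have : fastRegrowth θ η k H s x =
      (⋃ j, {ω | BelongsToFire θ (fun x k => η x k ω) k x j}) ∩
      ⋂ y, ⋂ (_ : y ≤ x), ⋂ (_ : H < y), ⋂ j,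
        ({ω | BelongsToFire θ (fun x k => η x k ω) k y j}ᶜ ∪ {ω | η y (j + 1) ω ≤ s}) := by
    ext ω
    simp [fastRegrowth, imp_iff_not_or]
  rw [this]
  exact (MeasurableSet.iUnion (hb x le_rfl)).inter <| MeasurableSet.iInter fun y =>
    MeasurableSet.iInter fun hy => MeasurableSet.iInter fun _ => MeasurableSet.iInter fun j =>
      (hb y hy j).compl.union (measurableSet_le (hm y hy _) measurable_const)

end Measurability

/-! ### Independence of regrowth times along a fire -/

section Probability

variable {Ω : Type*} [MeasurableSpace Ω] {P : Measure Ω} {θ : ℝ} {η : ℕ → ℕ → Ω → ℝ}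

/-- Split by the index `j` of the burning of `x + 1` in the fire. For each `j` the next waiting time
is independent of the past and costs a factor `q`; the events are disjoint in `j`, so summing loses
nothing. -/
lemma measure_fastRegrowth_succ_le (hθ : 0 < θ) (hη : ∀ x k ω, 0 ≤ η x k ω)
    (hm : ∀ x k, Measurable (η x k)) (hind : iIndepFun (fun p : ℕ × ℕ => η p.1 p.2) P)
    {s : ℝ} {q : ℝ≥0∞} (hq : ∀ x k, P {ω | η x k ω ≤ s} = q) (k H : ℕ) {x : ℕ} (hx : H ≤ x) :
    P (fastRegrowth θ η k H s (x + 1)) ≤ q * P (fastRegrowth θ η k H s x) := by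
  set E := fastRegrowth θ η k H s x
  let B : ℕ → Set Ω := fun j => {ω | BelongsToFire θ (fun x k => η x k ω) k (x + 1) j}
  have hsub : fastRegrowth θ η k H s (x + 1) ⊆
      ⋃ j, ((E ∩ B j) ∩ {ω | η (x + 1) (j + 1) ω ≤ s}) := by
    rintro ω ⟨⟨j, hj⟩, hy⟩
    obtain ⟨i, hi, -⟩ := id hj
    exact Set.mem_iUnion.2 ⟨j, ⟨⟨⟨i, hi⟩, fun y hyx => hy y (hyx.trans x.le_succ)⟩, hj⟩,
      hy _ le_rfl (by omega) j hj⟩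
  have hindep : ∀ j, P ((E ∩ B j) ∩ {ω | η (x + 1) (j + 1) ω ≤ s}) = P (E ∩ B j) * q := by
    intro j
    rw [← hq (x + 1) (j + 1)]
    -- The waiting times that decide `E ∩ B j`.
    let S : Set (ℕ × ℕ) := {p | p.1 ≤ x ∨ p.1 = x + 1 ∧ p.2 ≤ j}
    let F : ℕ × ℕ → MeasurableSpace Ω := fun p => MeasurableSpace.comap (η p.1 p.2) inferInstance
    have hdisj : Disjoint S {(x + 1, j + 1)} := by
      rw [Set.disjoint_singleton_right]
      simp [S]
    have hI := indep_iSup_of_disjoint (fun p : ℕ × ℕ => (hm p.1 p.2).comap_le)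
      hind.iIndep hdisj
    refine (Indep_iff _ _ _).1 hI _ _ ?_ ?_
    · have hF : ∀ p ∈ S, Measurable[⨆ p ∈ S, F p] (η p.1 p.2) := fun p hp =>
        (comap_measurable (η p.1 p.2)).mono (le_iSup₂ (f := fun p (_ : p ∈ S) => F p) p hp) le_rfl
      have hm' : ∀ y ≤ x, ∀ k, Measurable[⨆ p ∈ S, F p] (η y k) :=
        fun y hy k => hF (y, k) (Or.inl hy)
      have hi := measurable_ignition (m := ⨆ p ∈ S, F p) hθ hη hm'
      exact (measurableSet_fastRegrowth (m := ⨆ p ∈ S, F p) hθ hη hm' k H s).inter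
        (measurableSet_belongsToFire_succ (m := ⨆ p ∈ S, F p) hi
          (measurable_ignition_succ (m := ⨆ p ∈ S, F p) hθ hη hi
            (fun i hij => hF (x + 1, i) (Or.inr ⟨rfl, hij⟩)) le_rfl)
          (measurableSet_belongsToFire (m := ⨆ p ∈ S, F p) hθ hη hm' k))
    · have hT : Measurable[⨆ p ∈ ({(x + 1, j + 1)} : Set (ℕ × ℕ)), F p] (η (x + 1) (j + 1)) :=
        (comap_measurable (η (x + 1) (j + 1))).mono
          (le_iSup₂ (f := fun p (_ : p ∈ ({(x + 1, j + 1)} : Set (ℕ × ℕ))) => F p) _ rfl) le_rfl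
      exact hT measurableSet_Iic
  have hB : ∀ j, MeasurableSet (E ∩ B j) := fun j =>
    (measurableSet_fastRegrowth hθ hη (fun y _ => hm y) k H s).inter
      (measurableSet_belongsToFire hθ hη (fun y _ => hm y) k j)
  have hdis : Pairwise (Function.onFun Disjoint fun j => E ∩ B j) := fun i j hij =>
    Set.disjoint_left.2 fun ω hi hj =>
      hij (BelongsToFire.eq hθ (fun x k => hη x k ω) hi.2 hj.2)
  calc P (fastRegrowth θ η k H s (x + 1))
      ≤ ∑' j, P ((E ∩ B j) ∩ {ω | η (x + 1) (j + 1) ω ≤ s}) :=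
        (measure_mono hsub).trans (measure_iUnion_le _)
    _ = (∑' j, P (E ∩ B j)) * q := by simp_rw [hindep, ENNReal.tsum_mul_right]
    _ = P (⋃ j, E ∩ B j) * q := by rw [measure_iUnion hdis hB]
    _ ≤ q * P E := by
      rw [mul_comm]
      gcongr
      exact Set.iUnion_subset fun j => Set.inter_subset_left

lemma measure_fastRegrowth_le [IsProbabilityMeasure P] (hθ : 0 < θ) (hη : ∀ x k ω, 0 ≤ η x k ω)
    (hm : ∀ x k, Measurable (η x k)) (hind : iIndepFun (fun p : ℕ × ℕ => η p.1 p.2) P)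
    {s : ℝ} {q : ℝ≥0∞} (hq : ∀ x k, P {ω | η x k ω ≤ s} = q) (k H n : ℕ) :
    P (fastRegrowth θ η k H s (H + n)) ≤ q ^ n := by
  induction n with
  | zero => simpa using prob_le_one
  | succ n ih =>
    rw [pow_succ', ← add_assoc]
    exact (measure_fastRegrowth_succ_le hθ hη hm hind hq k H (by omega)).trans (by gcongr)

lemma measure_forall_waiting_le (hind : iIndepFun (fun p : ℕ × ℕ => η p.1 p.2) P)
    {s : ℝ} {q : ℝ≥0∞} (hq : ∀ x k, P {ω | η x k ω ≤ s} = q) (n : ℕ) :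
    P {ω | ∀ y < n, η y 0 ω ≤ s} = q ^ n := by
  have h0 : iIndepFun (fun y : ℕ => η y 0) P :=
    hind.precomp (g := fun y : ℕ => (y, 0)) fun a b h => (Prod.ext_iff.1 h).1
  have := h0.meas_biInter (S := Finset.range n) (s := fun y => {ω | η y 0 ω ≤ s})
    (fun y _ => ⟨Set.Iic s, measurableSet_Iic, rfl⟩)
  simp only [hq, Finset.prod_const, Finset.card_range] at this
  rw [← this]
  congr 1
  ext ω
  simp

end Probability

/-! ### Summable bounds -/

section Estimates

/-- The left side is at most `exp (-L ^ (1/4) / 3)`; the twelfth term of the exponential series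
turns this into `L ^ (-3)`, still summable after a union over `L` fires. -/
lemma one_sub_exp_pow_le {L n : ℕ} (hL : 2 ≤ L) (hn : L / 2 ≤ n) :
    (1 - Real.exp (-(3 / 4 * Real.log L))) ^ n ≤ (Nat.factorial 12 * 3 ^ 12 : ℝ) / L ^ 3 := by
  have hL0 : (0 : ℝ) < L := by positivity
  set y : ℝ := Real.exp (1 / 4 * Real.log L) with hy
  have hy12 : y ^ 12 = L ^ 3 := by
    rw [hy, ← Real.exp_nat_mul, ← Real.exp_log (pow_pos hL0 3), Real.log_pow]
    congr 1
    push_cast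
    ring
  have hn' : (L : ℝ) / 3 ≤ n := by
    rw [div_le_iff₀ (by norm_num)]
    exact_mod_cast (by omega : L ≤ n * 3)
  have hey : y / 3 ≤ n * Real.exp (-(3 / 4 * Real.log L)) := by
    have : y = L * Real.exp (-(3 / 4 * Real.log L)) := by
      have h := Real.exp_add (Real.log L) (-(3 / 4 * Real.log L))
      rw [Real.exp_log hL0] at h
      rw [hy, ← h]
      ring_nf
    rw [this]
    nlinarith [Real.exp_pos (-(3 / 4 * Real.log L))]
  have hlog : 0 ≤ Real.log L := Real.log_natCast_nonneg L
  have hexp := Real.pow_div_factorial_le_exp (y / 3) (by positivity) 12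
  calc (1 - Real.exp (-(3 / 4 * Real.log L))) ^ n
      ≤ Real.exp (-Real.exp (-(3 / 4 * Real.log L))) ^ n := by
        gcongr
        · rw [sub_nonneg, Real.exp_le_one_iff]
          linarith
        · linarith [Real.add_one_le_exp (-Real.exp (-(3 / 4 * Real.log L)))]
    _ = Real.exp (-(n * Real.exp (-(3 / 4 * Real.log L)))) := by
        rw [← Real.exp_nat_mul]
        ring_nf
    _ ≤ Real.exp (-(y / 3)) := by gcongr
    _ = (Real.exp (y / 3))⁻¹ := Real.exp_neg _
    _ ≤ ((y / 3) ^ 12 / Nat.factorial 12)⁻¹ := by gcongr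
    _ = (Nat.factorial 12 * 3 ^ 12 : ℝ) / L ^ 3 := by
        rw [div_pow, hy12]
        field_simp

lemma tsum_ofReal_ne_top {u : ℕ → ℝ} (hu : Summable u) (h : ∀ n, 0 ≤ u n) {a : ℕ → ℝ≥0∞}
    (ha1 : ∀ n, a n ≤ 1) (ha : ∀ᶠ n in atTop, a n ≤ ENNReal.ofReal (u n)) :
    ∑' n, a n ≠ ∞ := by
  obtain ⟨N, hN⟩ := eventually_atTop.1 ha
  rw [← (ENNReal.summable.sum_add_tsum_nat_add' (f := a) (k := N))]
  refine ENNReal.add_ne_top.2 ⟨?_, ?_⟩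
  · exact ENNReal.sum_ne_top.2 fun n _ => ((ha1 n).trans_lt ENNReal.one_lt_top).ne
  · refine ne_top_of_le_ne_top ?_ (ENNReal.tsum_le_tsum fun n => hN (n + N) (by omega))
    rw [← ENNReal.ofReal_tsum_of_nonneg (fun n => h (n + N)) ((summable_nat_add_iff N).2 hu)]
    exact ENNReal.ofReal_ne_top

end Estimates

/-! ### Borel–Cantelli -/

section AlmostSure

variable {Ω : Type*} [MeasurableSpace Ω] {P : Measure Ω} [IsProbabilityMeasure P] {θ : ℝ}
  {η : ℕ → ℕ → Ω → ℝ}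

lemma eventually_exists_waiting (hind : iIndepFun (fun p : ℕ × ℕ => η p.1 p.2) P)
    (hq : ∀ x k, ∀ s : ℝ, 0 ≤ s →
      P {ω | η x k ω ≤ s} = ENNReal.ofReal (1 - Real.exp (-s))) :
    ∀ᵐ ω ∂P, ∀ᶠ L : ℕ in atTop, ∃ y < L / 2, 3 / 4 * Real.log L < η y 0 ω := by
  have hsum : ∑' L : ℕ, P {ω | ∀ y < L / 2, η y 0 ω ≤ 3 / 4 * Real.log L} ≠ ∞ := by
    refine tsum_ofReal_ne_top (u := fun L : ℕ => (Nat.factorial 12 * 3 ^ 12 : ℝ) * (1 / L ^ 3))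
      ((Real.summable_one_div_nat_pow.2 (by norm_num)).mul_left _) (fun n => by positivity)
      (fun n => prob_le_one) ?_
    filter_upwards [eventually_ge_atTop 2] with L hL
    have hs : 0 ≤ 3 / 4 * Real.log L := by
      have := Real.log_natCast_nonneg L
      positivity
    have h1 : 0 ≤ 1 - Real.exp (-(3 / 4 * Real.log L)) := by
      rw [sub_nonneg, Real.exp_le_one_iff]
      linarith
    rw [measure_forall_waiting_le hind (fun x k => hq x k _ hs), ← ENNReal.ofReal_pow h1]
    refine ENNReal.ofReal_le_ofReal ?_
    rw [mul_one_div]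
    exact one_sub_exp_pow_le hL le_rfl
  filter_upwards [ae_eventually_notMem hsum] with ω hω
  filter_upwards [hω] with L hL
  simpa using hL

/-- The union over `k < L` costs a factor `L`; fires with `k ≥ L` start late enough to need no
regrowth estimate. -/
lemma eventually_notMem_fastRegrowth (hθ : 0 < θ) (hη : ∀ x k ω, 0 ≤ η x k ω)
    (hm : ∀ x k, Measurable (η x k)) (hind : iIndepFun (fun p : ℕ × ℕ => η p.1 p.2) P)
    (hq : ∀ x k, ∀ s : ℝ, 0 ≤ s →
      P {ω | η x k ω ≤ s} = ENNReal.ofReal (1 - Real.exp (-s))) :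
    ∀ᵐ ω ∂P, ∀ᶠ L : ℕ in atTop, ∀ k < L,
      ω ∉ fastRegrowth θ η k (L / 2) (3 / 4 * Real.log L) L := by
  have hsum : ∑' L : ℕ,
      P (⋃ k ∈ Finset.range L, fastRegrowth θ η k (L / 2) (3 / 4 * Real.log L) L) ≠ ∞ := by
    refine tsum_ofReal_ne_top (u := fun L : ℕ => (Nat.factorial 12 * 3 ^ 12 : ℝ) * (1 / L ^ 2))
      ((Real.summable_one_div_nat_pow.2 (by norm_num)).mul_left _) (fun n => by positivity)
      (fun n => prob_le_one) ?_
    filter_upwards [eventually_ge_atTop 2] with L hL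
    have hs : 0 ≤ 3 / 4 * Real.log L := by
      have := Real.log_natCast_nonneg L
      positivity
    have h1 : 0 ≤ 1 - Real.exp (-(3 / 4 * Real.log L)) := by
      rw [sub_nonneg, Real.exp_le_one_iff]
      linarith
    have hk : ∀ k, P (fastRegrowth θ η k (L / 2) (3 / 4 * Real.log L) L) ≤
        ENNReal.ofReal ((Nat.factorial 12 * 3 ^ 12 : ℝ) / L ^ 3) := by
      intro k
      have h := measure_fastRegrowth_le hθ hη hm hind (fun x k => hq x k _ hs) k (L / 2)
        (L - L / 2)
      rw [Nat.add_sub_cancel' (by omega), ← ENNReal.ofReal_pow h1] at h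
      exact h.trans (ENNReal.ofReal_le_ofReal (one_sub_exp_pow_le hL (by omega)))
    calc _ ≤ ∑ k ∈ Finset.range L, P (fastRegrowth θ η k (L / 2) (3 / 4 * Real.log L) L) :=
          measure_biUnion_finset_le _ _
      _ ≤ ∑ k ∈ Finset.range L, ENNReal.ofReal ((Nat.factorial 12 * 3 ^ 12 : ℝ) / L ^ 3) :=
          Finset.sum_le_sum fun k _ => hk k
      _ = ENNReal.ofReal ((Nat.factorial 12 * 3 ^ 12 : ℝ) * (1 / L ^ 2)) := by
          rw [Finset.sum_const, Finset.card_range, ← ENNReal.ofReal_nsmul, nsmul_eq_mul]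
          congr 1
          have : (L : ℝ) ≠ 0 := by positivity
          field_simp
  filter_upwards [ae_eventually_notMem hsum] with ω hω
  filter_upwards [hω] with L hL
  simpa using hL

/-- The exceptional probabilities are `L ^ (-5/4)`, hence summable. -/
lemma eventually_waiting_le (hm : ∀ x k, Measurable (η x k))
    (hq : ∀ x k, ∀ s : ℝ, 0 ≤ s →
      P {ω | η x k ω ≤ s} = ENNReal.ofReal (1 - Real.exp (-s))) :
    ∀ᵐ ω ∂P, ∀ᶠ L : ℕ in atTop, η L 0 ω ≤ 5 / 4 * Real.log L := by
  have hsum : ∑' L : ℕ, P {ω | η L 0 ω ≤ 5 / 4 * Real.log L}ᶜ ≠ ∞ := by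
    refine tsum_ofReal_ne_top (u := fun L : ℕ => 1 / (L : ℝ) ^ (5 / 4 : ℝ))
      (Real.summable_one_div_nat_rpow.2 (by norm_num)) (fun n => by positivity)
      (fun n => prob_le_one) ?_
    filter_upwards [eventually_ge_atTop 1] with L hL
    have hL0 : (0 : ℝ) < L := by positivity
    have hs : 0 ≤ 5 / 4 * Real.log L := by
      have := Real.log_natCast_nonneg L
      positivity
    rw [prob_compl_eq_one_sub (measurableSet_le (hm L 0) measurable_const), hq _ _ _ hs,
      ← ENNReal.ofReal_one, ← ENNReal.ofReal_sub]
    · refine ENNReal.ofReal_le_ofReal (le_of_eq ?_)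
      rw [Real.rpow_def_of_pos hL0, one_div, ← Real.exp_neg]
      ring_nf
    · rw [sub_nonneg, Real.exp_le_one_iff]
      linarith
  filter_upwards [ae_eventually_notMem hsum] with ω hω
  filter_upwards [hω] with L hL
  simpa using hL

end AlmostSure

/-! ### From one step to doubly exponential growth -/

section Growth

lemma eventually_exp_exp_le {m : ℕ → ℕ} (hm : StrictMono m)
    (h : ∀ᶠ M : ℕ in atTop, ∀ i, m i = M →
      11 / 10 * Real.log (m i + 1) ≤ Real.log (m (i + 1) + 1)) :
    ∀ᶠ i : ℕ in atTop, Real.exp (Real.exp (Real.log (21 / 20) * ((i : ℝ) + 1))) ≤ m i := by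
  obtain ⟨N, hN⟩ := eventually_atTop.1 h
  set a := max N 3
  have hstep : ∀ n, (11 / 10 : ℝ) ^ n * Real.log (m a + 1) ≤ Real.log (m (a + n) + 1) := by
    intro n
    induction n with
    | zero => simp
    | succ n ih =>
      have h1 := hN (m (a + n)) (((le_max_left N 3).trans (Nat.le_add_right a n)).trans (hm.id_le _)) _ rfl
      rw [pow_succ']
      calc (11 / 10 * (11 / 10) ^ n) * Real.log (m a + 1)
          = 11 / 10 * ((11 / 10 : ℝ) ^ n * Real.log (m a + 1)) := by ring
        _ ≤ 11 / 10 * Real.log (m (a + n) + 1) := by gcongr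
        _ ≤ _ := h1
  have ha : 3 ≤ m a := (le_max_right N 3).trans (hm.id_le _)
  have hv : 0 < Real.log (m a + 1) := Real.log_pos (by
    have : (3 : ℝ) ≤ m a := by exact_mod_cast ha
    linarith)
  -- As `11/10 = 22/21 * 21/20`, the spare factor `(22/21) ^ n` absorbs the starting value, the
  -- index shift and the 2 in `hlog`.
  have ht := (tendsto_pow_atTop_atTop_of_one_lt (r := (22 / 21 : ℝ)) (by norm_num)).eventually_ge_atTop
    (2 * (21 / 20) ^ (a + 1) / Real.log (m a + 1))
  obtain ⟨n₀, hn₀⟩ := eventually_atTop.1 ht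
  refine eventually_atTop.2 ⟨a + n₀, fun i hi => ?_⟩
  obtain ⟨n, rfl⟩ := Nat.exists_eq_add_of_le (show a ≤ i by omega)
  have hn := hn₀ n (by omega)
  rw [div_le_iff₀ hv] at hn
  have h3 : (3 : ℝ) ≤ m (a + n) := by exact_mod_cast ha.trans (hm.monotone (by omega))
  have hlog : Real.log (m (a + n) + 1) ≤ 2 * Real.log (m (a + n)) := by
    rw [← Real.log_rpow (by linarith)]
    refine Real.log_le_log (by linarith) ?_
    norm_num
    nlinarith
  have hexp : Real.exp (Real.log (21 / 20) * (((a + n : ℕ) : ℝ) + 1)) =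
      (21 / 20 : ℝ) ^ (a + 1) * (21 / 20) ^ n := by
    rw [← pow_add, mul_comm, ← Nat.cast_add_one, Real.exp_nat_mul, Real.exp_log (by norm_num)]
    ring_nf
  rw [← Real.le_log_iff_exp_le (by linarith), hexp]
  have h11 : (11 / 10 : ℝ) ^ n = (22 / 21) ^ n * (21 / 20) ^ n := by
    rw [← mul_pow]
    norm_num
  have hst := hstep n
  have hpos : (0 : ℝ) < (21 / 20) ^ n := by positivity
  rw [h11] at hst
  nlinarith

lemma eventually_log_maxima_le {θ : ℝ} {τ : ℕ → ℕ → ℝ} (hθ : 0 < θ) (hτ : ∀ x k, 0 ≤ τ x k)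
    (h1 : ∀ᶠ L : ℕ in atTop, ∃ y < L / 2, 3 / 4 * Real.log L < τ y 0)
    (h2 : ∀ᶠ L : ℕ in atTop, ∀ k < L, (∃ j, BelongsToFire θ τ k L j) →
      ∃ x ≤ L, L / 2 < x ∧ ∃ j, BelongsToFire θ τ k x j ∧ 3 / 4 * Real.log L < τ x (j + 1))
    (h3 : ∀ᶠ L : ℕ in atTop, τ L 0 ≤ 5 / 4 * Real.log L) :
    ∀ᶠ M : ℕ in atTop, ∀ i M' : ℕ, maxima θ τ i = M → maxima θ τ (i + 1) = M' →
      11 / 10 * Real.log (M + 1) ≤ Real.log (M' + 1) := by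
  have h4 : ∀ᶠ L : ℕ in atTop, 3 / 2 * Real.log L ≤ L * θ := by
    have h := (Real.isLittleO_log_id_atTop.comp_tendsto
      (tendsto_natCast_atTop_atTop (R := ℝ))).bound (show 0 < 2 / 3 * θ by positivity)
    filter_upwards [h] with L hL
    simp only [Function.comp_apply, id_eq, Real.norm_eq_abs, Nat.abs_cast] at hL
    linarith [le_abs_self (Real.log L)]
  obtain ⟨N, hN⟩ := eventually_atTop.1 h3
  filter_upwards [h1, h2, h4, eventually_ge_atTop N, eventually_ge_atTop (2 ^ 11)]
    with M h1 h2 h4 hNM hM i M' hi hi'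
  have hMM' : M < M' := by
    have := maxima_lt_succ hθ hτ (i := i) (by simp [hi])
    rw [hi, hi'] at this
    exact_mod_cast this
  obtain ⟨k, hk, hkθ, hx⟩ := exists_fire_of_maxima hθ hτ hi hi'
  have h3' := hN (M' + 1) (by omega)
  have hmain : 3 / 2 * Real.log M ≤ τ (M' + 1) 0 := by
    -- If `k ≥ M`, the `k * θ` elapsed before the fire already suffices, by `h4`.
    rcases lt_or_ge k M with hkM | hkM
    · obtain ⟨x, hxM, hHx, j, hj, hjs⟩ := h2 k hkM hk
      obtain ⟨y, hy, hys⟩ := h1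
      linarith [hx x hxM y (by omega) j hj]
    · have : (M : ℝ) * θ ≤ k * θ := by gcongr
      linarith
  have hM' : (2 ^ 11 : ℝ) ≤ M := by exact_mod_cast hM
  -- `M ≥ 2 ^ 11` is what turns `6/5 * log M` into `11/10 * log (M + 1)`.
  have hl1 : 11 * Real.log 2 ≤ Real.log M := by
    have := Real.log_le_log (by norm_num) hM'
    rw [Real.log_pow] at this
    exact_mod_cast this
  have hl2 : Real.log (M + 1) ≤ Real.log 2 + Real.log M := by
    rw [← Real.log_mul (by norm_num) (by linarith)]
    exact Real.log_le_log (by linarith) (by linarith)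
  push_cast at h3'
  linarith

end Growth

lemma ae_eventually_exp_exp_le_maxima {Ω : Type*} [MeasurableSpace Ω] {P : Measure Ω}
    [IsProbabilityMeasure P] {θ : ℝ} {η : ℕ → ℕ → Ω → ℝ} (hθ : 0 < θ)
    (hη : ∀ x k ω, 0 ≤ η x k ω) (hm : ∀ x k, Measurable (η x k))
    (hind : iIndepFun (fun p : ℕ × ℕ => η p.1 p.2) P)
    (hq : ∀ x k, ∀ s : ℝ, 0 ≤ s →
      P {ω | η x k ω ≤ s} = ENNReal.ofReal (1 - Real.exp (-s))) :
    ∀ᵐ ω ∂P, ∀ᶠ i : ℕ in atTop,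
      ENNReal.ofReal (Real.exp (Real.exp (Real.log (21 / 20) * ((i : ℝ) + 1)))) ≤
        ((maxima θ (fun x k => η x k ω) i : ℕ∞) : ℝ≥0∞) := by
  filter_upwards [eventually_exists_waiting hind hq,
    eventually_notMem_fastRegrowth hθ hη hm hind hq, eventually_waiting_le hm hq] with ω h1 h2 h3
  set τ : ℕ → ℕ → ℝ := fun x k => η x k ω
  have hτ : ∀ x k, 0 ≤ τ x k := fun x k => hη x k ω
  by_cases htop : ∃ i, maxima θ τ i = ⊤
  · obtain ⟨i₀, hi₀⟩ := htop
    filter_upwards [eventually_ge_atTop i₀] with i hi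
    have : maxima θ τ i = ⊤ := Nat.le_induction hi₀ (fun n _ h => maxima_succ_of_eq_top h) i hi
    simp [this]
  · push Not at htop
    choose m hmax using fun i => ENat.ne_top_iff_exists.1 (htop i)
    have hmono : StrictMono m := strictMono_nat_of_lt_succ fun i => by
      have := maxima_lt_succ hθ hτ (htop i)
      rw [← hmax, ← hmax] at this
      exact_mod_cast this
    have hgrow := eventually_log_maxima_le hθ hτ h1 (h2.mono fun L hL k hk hj => by
      have := hL k hk
      simp only [fastRegrowth, Set.mem_ofPred_eq, not_and] at this
      have h := this hj
      push Not at h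
      obtain ⟨x, hx, hHx, j, hj⟩ := h
      exact ⟨x, hx, hHx, j, hj⟩) h3
    filter_upwards [eventually_exp_exp_le hmono (hgrow.mono fun M hM i hi =>
      hi ▸ hM i (m (i + 1)) (by rw [← hmax, hi]) (hmax _).symm)] with i hi
    rw [← hmax i, ENat.toENNReal_coe, ← ENNReal.ofReal_natCast]
    exact ENNReal.ofReal_le_ofReal hi

lemma measure_setOf_le_of_hasLaw {Ω : Type*} [MeasurableSpace Ω] {P : Measure Ω} {X : Ω → ℝ}
    (hX : HasLaw X (expMeasure 1) P) {s : ℝ} (hs : 0 ≤ s) :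
    P {ω | X ω ≤ s} = ENNReal.ofReal (1 - Real.exp (-s)) := by
  have := isProbabilityMeasure_expMeasure one_pos
  have h := cdf_expMeasure_eq one_pos s
  rw [if_pos hs, one_mul] at h
  rw [hX.measure_eq measurableSet_Iic, ← h, ofReal_cdf]
  rfl

end ForestFire

theorem mainTheorem7 (θ : ℝ) (hθ : 0 < θ) :
    ∃ α : ℝ, 0 < α ∧
      ∀ (Ω : Type*) [MeasurableSpace Ω] (P : Measure Ω) [IsProbabilityMeasure P]
        (ξ : ℕ → ℕ → Ω → ℝ),
        (∀ x k, HasLaw (ξ x k) (expMeasure 1) P) →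
        iIndepFun (fun p : ℕ × ℕ => ξ p.1 p.2) P →
        ∀ᵐ ω ∂P, ∀ᶠ i : ℕ in atTop,
          ENNReal.ofReal (Real.exp (Real.exp (α * ((i : ℝ) + 1)))) ≤
            ((ForestFire.maxima θ (fun x k => ξ x k ω) i : ℕ∞) : ℝ≥0∞) := by
  refine ⟨Real.log (21 / 20), Real.log_pos (by norm_num), ?_⟩
  intro Ω _ P _ ξ hlaw hind
  -- A version that is measurable and nonnegative everywhere, almost surely equal to `ξ`.
  let η : ℕ → ℕ → Ω → ℝ := fun x k ω => max 0 ((hlaw x k).aemeasurable.mk (ξ x k) ω)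
  have hae : ∀ x k, ξ x k =ᵐ[P] η x k := by
    intro x k
    have h0 : P {ω | ξ x k ω ≤ 0} = 0 := by
      rw [ForestFire.measure_setOf_le_of_hasLaw (hlaw x k) le_rfl]
      simp
    filter_upwards [(hlaw x k).aemeasurable.ae_eq_mk, measure_eq_zero_iff_ae_notMem.1 h0]
      with ω h1 h2
    simp only [not_le] at h2
    simp only [η, ← h1, max_eq_right h2.le]
  have hall : ∀ᵐ ω ∂P, ∀ x k, ξ x k ω = η x k ω :=
    ae_all_iff.2 fun x => ae_all_iff.2 fun k => hae x k
  have hmain := ForestFire.ae_eventually_exp_exp_le_maxima (η := η) hθ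
    (fun x k ω => le_max_left _ _)
    (fun x k => measurable_const.max (hlaw x k).aemeasurable.measurable_mk)
    (hind.congr fun p => hae p.1 p.2) (fun x k s hs => by
      rw [← ForestFire.measure_setOf_le_of_hasLaw (hlaw x k) hs]
      refine measure_congr ?_
      filter_upwards [hae x k] with ω hω
      exact congrArg (· ≤ s) hω.symm)
  filter_upwards [hall, hmain] with ω h1 h2
  simpa only [h1] using h2
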